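/- A \emph{graph} is a structure $G=\langle V,s_1,s_2,\mathrm{null},\mathrm{root}\rangle$ where $V$ is a finite set of nodes, $\mathrm{root},\mathrm{null}\in V$ are distinct, and $s_1,s_2\subseteq V\times V$ satisfy, for every $x\in V$ and $i\in\{1,2\}$, $\langle \mathrm{null},x\rangle\in s_i$ iff $x=\mathrm{null}$. A \emph{heap} is a graph in which $s_1$ and $s_2$ are total functions $V\to V$ and every node $x\neq\mathrm{null}$ is reachable from $\mathrm{root}$ along $s_1$- and $s_2$-edges. A \emph{homomorphism} from $G$ to $G'=\langle V',s'_1,s'_2,\mathrm{null}',\mathrm{root}'\rangle$ is a map $h:V\to V'$ such that $\langle x,y\rangle\in s_i$ implies $\langle h(x),h(y)\rangle\in s'_i$ for $i\in\{1,2\}$, $h(x)=\mathrm{root}'$ iff $x=\mathrm{root}$, and $h(x)=\mathrm{null}'$ iff $x=\mathrm{null}$; write $G\to G'$ if one exists. A graph $G_1$ \emph{implies} a graph $G_2$ over the class of heaps if, for every heap $H$, $H\to G_1$ implies $H\to G_2$. \textbf{Theorem.} The implication of graphs over the class of heaps is undecidable: there is no algorithm which, given (finite descriptions of) two graphs $G_1$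 and $G_2$, decides whether $G_1$ implies $G_2$ over the class of heaps. -/

import Mathlib

namespace RegularGraph

/-- A graph: a finite set of nodes with two edge relations `s 0` and `s 1` (written `s₁`, `s₂` in
mathematical notation) and two distinct constants `null` and `root`, such that for either label the
only edge that leaves `null` is the loop at `null`.  Since node sets are finite, node sets in `Type`
represent all graphs up to isomorphism. -/
structure Graph where
  V : Type
  finite : Finite V
  s : Fin 2 → V → V → Prop
  null : V
  root : V
  root_ne_null : root ≠ null
  null_edge : ∀ (i : Fin 2) (x : V), s i null x ↔ x = null

/-- A heap: both edge relations are total functions, and every node other than `null` is reachable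
from `root` along edges of either label. -/
def IsHeap (G : Graph) : Prop :=
  (∀ (i : Fin 2) (x : G.V), ∃! y : G.V, G.s i x y) ∧
    ∀ x : G.V, x ≠ G.null → Relation.ReflTransGen (fun y z => ∃ i, G.s i y z) G.root x

/-- Graph homomorphisms; the constants are preserved and reflected. -/
def IsHom (G G' : Graph) (h : G.V → G'.V) : Prop :=
  (∀ (i : Fin 2) (x y : G.V), G.s i x y → G'.s i (h x) (h y)) ∧
    (∀ x : G.V, h x = G'.root ↔ x = G.root) ∧
    (∀ x : G.V, h x = G'.null ↔ x = G.null)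

/-- `G → G'`: the graph `G` satisfies the regular graph constraint given by `G'`. -/
def Satisfies (G G' : Graph) : Prop :=
  ∃ h : G.V → G'.V, IsHom G G' h

/-- `G₁` implies `G₂` over the class `C` of graphs. -/
def ImpliesOver (C : Graph → Prop) (G₁ G₂ : Graph) : Prop :=
  ∀ H : Graph, C H → Satisfies H G₁ → Satisfies H G₂

/-- A finite description `(n, E₁, E₂)` of a graph with `n + 2` nodes, by two lists of edges. -/
abbrev GraphCode : Type := ℕ × List (ℕ × ℕ) × List (ℕ × ℕ)

/-- The list of edges with label `i` in a description. -/
def GraphCode.edges (c : GraphCode) (i : Fin 2) : List (ℕ × ℕ) :=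
  if i = 0 then c.2.1 else c.2.2

/-- The graph described by `(n, E₁, E₂)`: its nodes are `0, …, n + 1`, with `null = 0` and
`root = 1`, and its edges with a source other than `null` are those listed; the edges that leave
`null` are prescribed and need not be listed. -/
def GraphCode.toGraph (c : GraphCode) : Graph where
  V := Fin (c.1 + 2)
  finite := inferInstance
  s := fun i x y => if x = 0 then y = 0 else ((x : ℕ), (y : ℕ)) ∈ GraphCode.edges c i
  null := 0
  root := 1
  root_ne_null := by simp
  null_edge := by simp

/-- Every graph is described by some code, up to isomorphism. -/
theorem GraphCode.exists_iso (G : Graph) :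
    ∃ (c : GraphCode) (e : G.V ≃ (GraphCode.toGraph c).V),
      e G.null = (GraphCode.toGraph c).null ∧ e G.root = (GraphCode.toGraph c).root ∧
        ∀ i x y, G.s i x y ↔ (GraphCode.toGraph c).s i (e x) (e y) := by
  classical
  have := G.finite
  have : Nontrivial G.V := ⟨⟨G.root, G.null, G.root_ne_null⟩⟩
  obtain ⟨n, hn⟩ : ∃ n, Nat.card G.V = n + 2 :=
    ⟨Nat.card G.V - 2, by have := Finite.one_lt_card (α := G.V); omega⟩
  obtain ⟨e, he0, he1⟩ : ∃ e : G.V ≃ Fin (n + 2), e G.null = 0 ∧ e G.root = 1 := by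
    let e0 : G.V ≃ Fin (n + 2) := (Finite.equivFin G.V).trans (finCongr hn)
    let e1 := e0.trans (Equiv.swap (e0 G.null) 0)
    have h1 : e1 G.null = 0 := by simp [e1]
    have h2 : e1 G.root ≠ 0 := fun h => G.root_ne_null (e1.injective (h.trans h1.symm))
    refine ⟨e1.trans (Equiv.swap (e1 G.root) 1), ?_, by simp⟩
    rw [Equiv.trans_apply, h1]
    exact Equiv.swap_apply_of_ne_of_ne h2.symm (by simp)
  let E : Fin 2 → List (ℕ × ℕ) := fun i =>
    ((Finset.univ.filter fun p : Fin (n + 2) × Fin (n + 2) =>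
      G.s i (e.symm p.1) (e.symm p.2)).toList).map fun p => ((p.1 : ℕ), (p.2 : ℕ))
  have hE : ∀ (i : Fin 2) (x y : Fin (n + 2)), ((x : ℕ), (y : ℕ)) ∈ E i ↔ G.s i (e.symm x) (e.symm y) := by
    intro i x y
    simp only [E, List.mem_map, Finset.mem_toList, Finset.mem_filter, Finset.mem_univ, true_and,
      Prod.mk.injEq, Prod.exists]
    constructor
    · rintro ⟨a, b, hab, ha, hb⟩
      rwa [← Fin.ext ha, ← Fin.ext hb]
    · exact fun h => ⟨x, y, h, rfl, rfl⟩
  have hc : ∀ i, GraphCode.edges (n, E 0, E 1) i = E i := by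
    intro i
    fin_cases i <;> simp [GraphCode.edges]
  refine ⟨(n, E 0, E 1), e, he0, he1, fun i x y => ?_⟩
  change _ ↔ if e x = 0 then e y = 0 else _ ∈ _
  rw [hc]
  split_ifs with hx
  · have hx' : x = G.null := e.injective (hx.trans he0.symm)
    rw [hx', G.null_edge, ← he0, e.injective.eq_iff]
  · refine Iff.trans ?_ (hE i (e x) (e y)).symm
    rw [Equiv.symm_apply_apply, Equiv.symm_apply_apply]

end RegularGraph

/-!
The halting problem reduces to the complement of graph implication. The first graph depends on the
input, the second one is fixed; the implication fails if and only if there is a heap that encodes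
a halting run of a fixed machine on the input.

*The machine.* By `exists_code_not_computablePred` there is one program whose halting on the inputs
`2 ^ n - 1` is undecidable. Mathlib compiles it to a machine with four stacks, and `simulator`
executes that machine while treating its stacks in turn: a step changes the first stack of a queue
of four and moves it to the end of the queue (`RotaryMachine`).

*Runs as heaps.* Following first edges from `root`, one meets the nodes `y 0, y 1, …` of the main
path, and the second edge of `y t` points to the first stack of the queue at time `t`. A stack is a
linked list along first edges, whose letters are encoded in unary along second edges. Lists are
persistent, so a heap records a run if and only if, for each `t`, the stack of `y (t + 4)` results
by the operation of step `t` from the stack of `y t`, which amounts to an equation between nodes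
that short paths reach from `y t`.

*Errors as homomorphisms.* A homomorphism from a heap is a colouring of its nodes that respects the
edges. The colours of `errorGraph` let the main path be followed together with the state of the
machine, up to a step at which an equation is claimed to fail. That two nodes are distinct is
witnessed by a two-valued labelling of all nodes which separates them; four nodes later the colours
compare the values. A second kind of colour is available when the main path never reaches `null`.
If the machine does not halt, then every heap with the right initial stacks can be coloured in this
way: either its main path is cyclic, or its first wrong stack gives an error, or the run simply goes
on until `null` is reached (`satisfies_errorGraph_of_not_halts`). If the machine halts, then the
heap that records the run up to that moment cannot be coloured, since the halting configuration has
no successor (`not_satisfies_errorGraph_runHeap`).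

*The input.* A homomorphism into the graph described by `inputCode n` forces the initial stacks to
be those of the input `2 ^ n - 1`, and this description is primitive recursive in `n`. The error
graph does not depend on `n`, so any description of it serves.
-/

namespace RegularGraph

open Turing.PartrecToTM2 (Γ')

/-! ### Rotary machines -/

/-- What a machine does to the stack it has just inspected. -/
inductive StackOp
  | keep
  | pop
  | push (a : Γ')

/-- The effect of an operation on the contents of a stack, whose top is the head of the list.
Popping an empty stack leaves it empty. -/
def StackOp.apply : StackOp → List Γ' → List Γ'
  | keep, l => l
  | pop, l => l.tail
  | push a, l => a :: l

/-- A configuration of a machine with four stacks, which are arranged in a queue. -/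
structure RotaryCfg (Q : Type) where
  state : Q
  first : List Γ'
  second : List Γ'
  third : List Γ'
  fourth : List Γ'

/-- The transition table of a four-stack machine. In each step the machine inspects the top of the
first stack of the queue (`none` if that stack is empty), changes its state, operates on that stack
and moves it to the end of the queue; `none` as the value of the table means that it halts. -/
abbrev RotaryMachine (Q : Type) : Type := Q → Option Γ' → Option (Q × StackOp)

namespace RotaryMachine

variable {Q : Type} (M : RotaryMachine Q)

/-- The step function of a rotary machine. -/
def step (c : RotaryCfg Q) : Option (RotaryCfg Q) :=
  (M c.state c.first.head?).map fun r =>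
    ⟨r.1, c.second, c.third, c.fourth, r.2.apply c.first⟩

/-- A total version of `step`: a halted machine keeps rotating its stacks. -/
def advance (c : RotaryCfg Q) : RotaryCfg Q :=
  let r := (M c.state c.first.head?).getD (c.state, StackOp.keep)
  ⟨r.1, c.second, c.third, c.fourth, r.2.apply c.first⟩

/-- The configuration at time `t` of the run that starts in `c`. -/
def run (c : RotaryCfg Q) (t : ℕ) : RotaryCfg Q := M.advance^[t] c

variable {M}

@[simp] theorem run_zero (c : RotaryCfg Q) : M.run c 0 = c := rfl

theorem run_succ (c : RotaryCfg Q) (t : ℕ) : M.run c (t + 1) = M.advance (M.run c t) :=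
  Function.iterate_succ_apply' _ _ _

theorem step_eq_none_iff {c : RotaryCfg Q} :
    M.step c = none ↔ M c.state c.first.head? = none := by
  simp [step]

theorem step_eq_advance {c : RotaryCfg Q} (h : M c.state c.first.head? ≠ none) :
    M.step c = some (M.advance c) := by
  obtain ⟨r, hr⟩ := Option.ne_none_iff_exists'.1 h
  simp [step, advance, hr]

theorem run_state {c : RotaryCfg Q} {t : ℕ} {r : Q × StackOp}
    (h : M (M.run c t).state (M.run c t).first.head? = some r) :
    (M.run c (t + 1)).state = r.1 := by
  simp [run_succ, advance, h]

theorem run_first_add_four {c : RotaryCfg Q} {t : ℕ} {r : Q × StackOp}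
    (h : M (M.run c t).state (M.run c t).first.head? = some r) :
    (M.run c (t + 4)).first = r.2.apply (M.run c t).first := by
  rw [run_succ, run_succ, run_succ, run_succ]
  simp [advance, h]

theorem eval_dom_iff (c : RotaryCfg Q) :
    (StateTransition.eval M.step c).Dom ↔
      ∃ t, M (M.run c t).state (M.run c t).first.head? = none := by
  constructor
  · intro h
    obtain ⟨b, hb⟩ := Part.dom_iff_mem.1 h
    obtain ⟨hr, hn⟩ := StateTransition.mem_eval.1 hb
    have key : ∀ b, StateTransition.Reaches M.step c b → ∃ t, M.run c t = b := by
      intro b hb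
      induction hb with
      | refl => exact ⟨0, rfl⟩
      | @tail b b' _ hstep ih =>
        obtain ⟨t, rfl⟩ := ih
        refine ⟨t + 1, ?_⟩
        have hne : M (M.run c t).state (M.run c t).first.head? ≠ none := by
          intro h0
          rw [step_eq_none_iff.2 h0] at hstep
          simp at hstep
        rw [step_eq_advance hne] at hstep
        rw [run_succ]
        simpa using hstep
    obtain ⟨t, rfl⟩ := key b hr
    exact ⟨t, step_eq_none_iff.1 hn⟩
  · intro h
    classical
    have hfind := Nat.find_spec h
    have key : ∀ t ≤ Nat.find h, StateTransition.Reaches M.step c (M.run c t) := by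
      intro t
      induction t with
      | zero => intro _; exact Relation.ReflTransGen.refl
      | succ t ih =>
        intro ht
        refine (ih (by omega)).tail ?_
        rw [run_succ, step_eq_advance (Nat.find_min h (by omega))]
        rfl
    exact Part.dom_iff_mem.2 ⟨_, StateTransition.mem_eval.2
      ⟨key _ le_rfl, step_eq_none_iff.2 hfind⟩⟩

end RotaryMachine

/-! ### Stacks in a heap -/

/-- The letter of a stack cell is the number of second edges that lead from the cell to `null`;
`nextLetter` passes from the letter of the target of a second edge to that of its source. -/
def nextLetter : Option Γ' → Γ'
  | none => .cons
  | some .cons => .bit1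
  | some .bit1 => .bit0
  | some .bit0 => .consₗ
  | some .consₗ => .consₗ

/-- A stack whose cell is a suitable target of the second edge of a cell with letter `a`. -/
def letterTail : Γ' → List Γ'
  | .cons => []
  | .bit1 => [.cons]
  | .bit0 => [.bit1]
  | .consₗ => [.bit0]

section Store

variable {V : Type} (s : Fin 2 → V → V) (null : V)

open Classical in
/-- The letter of a node, where at most `n` second edges are followed. -/
noncomputable def letterWithin : ℕ → V → Option Γ'
  | 0, _ => some .consₗ
  | n + 1, x => if x = null then none else some (nextLetter (letterWithin n (s 1 x)))

/-- The letter on top of the stack that a node represents. There are four letters, so following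
four edges suffices; longer chains (and infinite ones) count as the last letter. -/
noncomputable def letter : V → Option Γ' := letterWithin s null 4

theorem letter_null : letter s null null = none := by
  simp [letter, letterWithin]

variable {null} in
theorem letter_of_ne {x : V} (h : x ≠ null) :
    letter s null x = some (nextLetter (letter s null (s 1 x))) := by
  simp only [letter, letterWithin, if_neg h]
  split_ifs <;> rfl

/-- `Represents s null l x`: the chain of first edges that starts at `x` spells the stack `l`. -/
def Represents : List Γ' → V → Prop
  | [], x => x = null
  | a :: l, x => letter s null x = some a ∧ Represents l (s 0 x)

variable {s null}

theorem Represents.letter_eq {l : List Γ'} {x : V} (h : Represents s null l x) :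
    letter s null x = l.head? := by
  cases l with
  | nil => rw [show x = null from h, letter_null]; rfl
  | cons a l => exact h.1

theorem Represents.tail (h0 : s 0 null = null) {l : List Γ'} {x : V}
    (h : Represents s null l x) : Represents s null l.tail (s 0 x) := by
  cases l with
  | nil => rw [show x = null from h, h0]; rfl
  | cons a l => exact h.2

end Store

/-! ### The error graph -/

/-- What a colour records about a node: its letter, a guessed bit, and the guessed bit of the target
of its first edge. Bits serve to witness that two nodes are distinct. -/
structure Profile where
  letter : Option Γ'
  bit : Bool
  tailBit : Bool

/-- The profile of `null`. -/
def Profile.null : Profile := ⟨none, false, false⟩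

instance : Finite Profile :=
  Finite.of_injective (β := Option Γ' × Bool × Bool)
    (fun p => (p.letter, p.bit, p.tailBit)) fun p q h => by
      cases p; cases q; simpa using h

/-- The profiles of a node which show that it does not result by the operation from a node with
profile `p`. -/
def StackOp.violations : StackOp → Profile → Set Profile
  | keep, p => {p' | p'.bit ≠ p.bit}
  | pop, p => {p' | p'.bit ≠ p.tailBit}
  | push a, p => {p' | p'.letter ≠ some a ∨ p'.tailBit ≠ p.bit}

/-- What a colour records about the position of a node on the main path. -/
inductive Stage {Q : Type} (F : Set Q)
  /-- The node is not on the main path. -/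
  | off
  /-- The main path is claimed never to reach `null`. -/
  | cyclic
  /-- No error has been claimed so far; the machine is in the given state. -/
  | run (q : F)
  /-- An error is claimed to show up `n` nodes later, in a stack with profile in `T`. -/
  | wait (n : Fin 4) (T : Set Profile)
  /-- The claimed error has been verified. -/
  | done

section ErrorGraph

variable {Q : Type} (M : RotaryMachine Q) (F : Set Q)

instance [Finite F] : Finite (Stage F) :=
  Finite.of_surjective (α := Fin 3 ⊕ F ⊕ (Fin 4 × Set Profile))
    (fun x => match x with
      | .inl 0 => .off
      | .inl 1 => .cyclic
      | .inl 2 => .done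
      | .inr (.inl q) => .run q
      | .inr (.inr (n, T)) => .wait n T)
    (by
      rintro (_ | _ | q | ⟨n, T⟩ | _)
      exacts [⟨.inl 0, rfl⟩, ⟨.inl 1, rfl⟩, ⟨.inr (.inl q), rfl⟩, ⟨.inr (.inr (n, T)), rfl⟩,
        ⟨.inl 2, rfl⟩])

variable {F}

/-- The stages that the next node of the main path may have, for a node whose stack has
profile `p`. -/
def Stage.Next : Stage F → Profile → Stage F → Prop
  | off, _, _ => True
  | cyclic, _, σ => σ = cyclic
  | run q, p, σ => ∃ r, M q p.letter = some r ∧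
      ((∃ h : r.1 ∈ F, σ = run ⟨r.1, h⟩) ∨ σ = wait 3 (r.2.violations p))
  | wait n T, p, σ => (n = 0 ∧ p ∈ T ∧ σ = done) ∨ ∃ m : Fin 4, m.val + 1 = n.val ∧ σ = wait m T
  | done, _, σ => σ = done

/-- The stages of a node with a stack of profile `p` that may be followed by `null`. -/
def Stage.Final : Stage F → Profile → Prop
  | off, _ => True
  | cyclic, _ => False
  | run _, _ => True
  | wait n T, p => n = 0 ∧ p ∈ T
  | done, _ => True

/-- The nodes of the error graph, to be thought of as colours: those other than `null` and `root`
record the profile of a node, the profile of the target of its second edge, and its stage. -/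
inductive Colour (F : Set Q)
  | null
  | root
  | node (p p' : Profile) (σ : Stage F)

instance [Finite F] : Finite (Colour F) :=
  Finite.of_surjective (α := Fin 2 ⊕ Profile × Profile × Stage F)
    (fun x => match x with
      | .inl 0 => .null
      | .inl 1 => .root
      | .inr (p, p', σ) => .node p p' σ)
    (by
      rintro (_ | _ | ⟨p, p', σ⟩)
      exacts [⟨.inl 0, rfl⟩, ⟨.inl 1, rfl⟩, ⟨.inr (p, p', σ), rfl⟩])

/-- The profile that a colour ascribes to a node; the value at `root` is irrelevant. -/
def Colour.profile : Colour F → Profile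
  | null => .null
  | root => .null
  | node p _ _ => p

/-- First edges between colours. -/
def Colour.Edge₁ (q₀ : F) : Colour F → Colour F → Prop
  | null, y => y = null
  | root, node _ _ σ => σ = .cyclic ∨ σ = .run q₀
  | root, _ => False
  | node p p' σ, null => p.tailBit = false ∧ σ.Final p'
  | node p p' σ, node r _ τ => p.tailBit = r.bit ∧ σ.Next M p' τ
  | node _ _ _, root => False

/-- Second edges between colours. -/
def Colour.Edge₂ : Colour F → Colour F → Prop
  | null, y => y = null
  | root, y => y = null
  | node _ _ _, root => False
  | node p p' _, y => p' = y.profile ∧ p.letter = some (nextLetter y.profile.letter)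

/-- The error graph. A heap with the right initial stacks maps to it if and only if its main path,
along first edges from `root`, does not record a halting run of the machine from the state `q₀`. -/
def errorGraph [Finite F] (q₀ : F) : Graph where
  V := Colour F
  finite := inferInstance
  s := fun i => if i = 0 then Colour.Edge₁ M q₀ else Colour.Edge₂
  null := .null
  root := .root
  root_ne_null := by simp
  null_edge := by
    intro i x
    fin_cases i <;> simp [Colour.Edge₁, Colour.Edge₂]

end ErrorGraph

/-! ### Heaps that do not record a halting run have an error -/

section Soundness

variable {Q : Type} {M : RotaryMachine Q} {F : Set Q} [Finite F] {q₀ : F}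
variable {H : Graph} {s : Fin 2 → H.V → H.V}

/-- A colouring of a heap amounts to a choice of bits and stages, since the remaining parts of the
colours are determined by the heap. -/
theorem satisfies_errorGraph_of_stage (hs : ∀ i x y, H.s i x y ↔ s i x = y)
    (hroot : ∀ i x, s i x ≠ H.root) (hroot₁ : s 0 H.root ≠ H.null) (hroot₂ : s 1 H.root = H.null)
    (bit : H.V → Bool) (hbit : bit H.null = false) (σ : H.V → Stage F)
    (hstart : σ (s 0 H.root) = .cyclic ∨ σ (s 0 H.root) = .run q₀)
    (hfinal : ∀ x, x ≠ H.null → s 0 x = H.null →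
      (σ x).Final ⟨letter s H.null (s 1 x), bit (s 1 x), bit (s 0 (s 1 x))⟩)
    (hnext : ∀ x, x ≠ H.null → s 0 x ≠ H.null →
      (σ x).Next M ⟨letter s H.null (s 1 x), bit (s 1 x), bit (s 0 (s 1 x))⟩ (σ (s 0 x))) :
    Satisfies H (errorGraph M q₀) := by
  classical
  have hnull : ∀ i, s i H.null = H.null := fun i => (hs i _ _).1 ((H.null_edge i _).2 rfl)
  let prof : H.V → Profile := fun x => ⟨letter s H.null x, bit x, bit (s 0 x)⟩
  have hprof : prof H.null = .null := by
    simp only [prof, letter_null, hnull, hbit, Profile.null]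
  let col : H.V → Colour F := fun x =>
    if x = H.null then .null else if x = H.root then .root else .node (prof x) (prof (s 1 x)) (σ x)
  have col_null : col H.null = .null := if_pos rfl
  have col_root : col H.root = .root := by simp [col, H.root_ne_null]
  have col_node : ∀ x, x ≠ H.null → x ≠ H.root →
      col x = .node (prof x) (prof (s 1 x)) (σ x) := fun x h1 h2 => by simp [col, h1, h2]
  have col_prof : ∀ x, x ≠ H.root → (col x).profile = prof x := by
    intro x hx
    by_cases h : x = H.null
    · rw [h, col_null, hprof]; rfl
    · rw [col_node x h hx]; rfl
  refine ⟨col, ?_, ?_, ?_⟩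
  · intro i x y hxy
    obtain rfl := (hs i x y).1 hxy
    by_cases hx : x = H.null
    · rw [hx, hnull, col_null]
      exact ((errorGraph M q₀).null_edge i _).2 rfl
    fin_cases i
    · change Colour.Edge₁ M q₀ (col x) (col (s 0 x))
      by_cases hxr : x = H.root
      · rw [hxr, col_root, col_node _ hroot₁ (hroot 0 _)]
        exact hstart
      · rw [col_node x hx hxr]
        by_cases hy : s 0 x = H.null
        · rw [hy, col_null]
          refine ⟨?_, hfinal x hx hy⟩
          simp only [prof, hy, hbit]
        · rw [col_node _ hy (hroot 0 _)]
          exact ⟨rfl, hnext x hx hy⟩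
    · change Colour.Edge₂ (col x) (col (s 1 x))
      by_cases hxr : x = H.root
      · rw [hxr, col_root, hroot₂, col_null]
        rfl
      · have hcol := col_prof (s 1 x) (hroot 1 x)
        have hne : col (s 1 x) ≠ .root := by
          by_cases hy : s 1 x = H.null
          · rw [hy, col_null]; simp
          · rw [col_node _ hy (hroot 1 _)]; simp
        rw [col_node x hx hxr]
        have hl : (prof x).letter = some (nextLetter (prof (s 1 x)).letter) := letter_of_ne s hx
        revert hne hcol
        cases col (s 1 x) with
        | root => intro _ h; exact absurd rfl h
        | null => intro h _; exact ⟨h.symm, by rw [h]; exact hl⟩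
        | node => intro h _; exact ⟨h.symm, by rw [h]; exact hl⟩
  · intro x
    change col x = .root ↔ _
    by_cases h1 : x = H.null
    · subst h1; simp [col_null, H.root_ne_null.symm]
    · by_cases h2 : x = H.root
      · simp [h2, col_root]
      · simp [col_node x h1 h2, h2]
  · intro x
    change col x = .null ↔ _
    by_cases h1 : x = H.null
    · simp [h1, col_null]
    · by_cases h2 : x = H.root
      · simp [h2, col_root, H.root_ne_null]
      · simp [col_node x h1 h2, h1]

/-- If the main path reaches `null`, then its nodes are distinct, and stages can be assigned to
them in turn. -/
theorem satisfies_errorGraph_of_path (hs : ∀ i x y, H.s i x y ↔ s i x = y)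
    (hroot : ∀ i x, s i x ≠ H.root) (hroot₁ : s 0 H.root ≠ H.null) (hroot₂ : s 1 H.root = H.null)
    (bit : H.V → Bool) (hbit : bit H.null = false) (y : ℕ → H.V) (hy0 : y 0 = s 0 H.root)
    (hy : ∀ t, y (t + 1) = s 0 (y t)) {N : ℕ} (hN : y N = H.null) (σ : ℕ → Stage F)
    (hstart : σ 0 = .run q₀)
    (hfinal : ∀ t, y t ≠ H.null → y (t + 1) = H.null → (σ t).Final
      ⟨letter s H.null (s 1 (y t)), bit (s 1 (y t)), bit (s 0 (s 1 (y t)))⟩)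
    (hnext : ∀ t, y (t + 1) ≠ H.null → (σ t).Next M
      ⟨letter s H.null (s 1 (y t)), bit (s 1 (y t)), bit (s 0 (s 1 (y t)))⟩ (σ (t + 1))) :
    Satisfies H (errorGraph M q₀) := by
  classical
  have hnull : ∀ i, s i H.null = H.null := fun i => (hs i _ _).1 ((H.null_edge i _).2 rfl)
  have habs : ∀ k, y (N + k) = H.null := by
    intro k
    induction k with
    | zero => exact hN
    | succ k ih => rw [← add_assoc, hy, ih, hnull]
  have hshift : ∀ i j, y i = y j → ∀ k, y (i + k) = y (j + k) := by
    intro i j hij k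
    induction k with
    | zero => exact hij
    | succ k ih => rw [← add_assoc, ← add_assoc, hy, hy, ih]
  have hlt : ∀ i j, i < j → y i = y j → y i = H.null := by
    intro i j hlt hij
    have hmul : ∀ k, y i = y (i + k * (j - i)) := by
      intro k
      induction k with
      | zero => simp
      | succ k ih =>
        rw [show i + (k + 1) * (j - i) = j + k * (j - i) by
          rw [add_mul, one_mul]; omega]
        exact ih.trans (hshift i j hij _)
    rw [hmul N]
    have : N ≤ N * (j - i) := Nat.le_mul_of_pos_right _ (by omega)
    obtain ⟨k, hk⟩ := Nat.exists_eq_add_of_le (show N ≤ i + N * (j - i) by omega)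
    rw [hk, habs]
  have hinj : ∀ i j, y i ≠ H.null → y i = y j → i = j := by
    intro i j hi hij
    rcases lt_trichotomy i j with h | h | h
    · exact absurd (hlt i j h hij) hi
    · exact h
    · exact absurd (hij ▸ hlt j i h hij.symm) hi
  let τ : H.V → Stage F := fun x => if h : ∃ t, y t = x then σ h.choose else .off
  have hτ : ∀ t, y t ≠ H.null → τ (y t) = σ t := by
    intro t ht
    have h : ∃ t', y t' = y t := ⟨t, rfl⟩
    simp only [τ, dif_pos h]
    exact congrArg σ (hinj t _ ht h.choose_spec.symm).symm
  have hτoff : ∀ x, (¬∃ t, y t = x) → τ x = .off := fun x h => dif_neg h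
  refine satisfies_errorGraph_of_stage hs hroot hroot₁ hroot₂ bit hbit τ ?_ ?_ ?_
  · right
    rw [← hy0, hτ 0 (by rwa [hy0]), hstart]
  · intro x hx hx0
    by_cases h : ∃ t, y t = x
    · obtain ⟨t, rfl⟩ := h
      rw [hτ t hx]
      exact hfinal t hx (by rw [hy, hx0])
    · rw [hτoff x h]; trivial
  · intro x hx hx0
    by_cases h : ∃ t, y t = x
    · obtain ⟨t, rfl⟩ := h
      rw [hτ t hx]
      rw [← hy] at hx0 ⊢
      rw [hτ _ hx0]
      exact hnext t hx0
    · rw [hτoff x h]; trivial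

/-- A bit assignment that tells two distinct nodes apart. -/
theorem exists_bit_ne {V : Type} (null : V) {u v : V} (h : u ≠ v) :
    ∃ bit : V → Bool, bit null = false ∧ bit u ≠ bit v := by
  classical
  by_cases hu : u = null
  · exact ⟨fun x => decide (x = v), by simp [← hu, h], by simp [h]⟩
  · exact ⟨fun x => decide (x = u), by simp [Ne.symm hu], by simp [h.symm]⟩

/-- If the stack `z` is not the result of the operation on the stack `x`, then the bits can be
guessed so that the profiles show it. -/
theorem exists_bit_violation {V : Type} {s : Fin 2 → V → V} {null : V} (h0 : s 0 null = null)
    {l : List Γ'} {x z : V} (hx : Represents s null l x) (op : StackOp)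
    (hz : ¬Represents s null (op.apply l) z) :
    ∃ bit : V → Bool, bit null = false ∧
      (⟨letter s null z, bit z, bit (s 0 z)⟩ : Profile) ∈
        op.violations ⟨letter s null x, bit x, bit (s 0 x)⟩ := by
  cases op with
  | keep => exact exists_bit_ne null (u := z) (v := x) (by rintro rfl; exact hz hx)
  | pop => exact exists_bit_ne null (u := z) (v := s 0 x) (by rintro rfl; exact hz (hx.tail h0))
  | push a =>
    by_cases hl : letter s null z = some a
    · obtain ⟨bit, h1, h2⟩ := exists_bit_ne null (u := s 0 z) (v := x)
        (fun h => hz ⟨hl, h ▸ hx⟩)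
      exact ⟨bit, h1, Or.inr h2⟩
    · exact ⟨fun _ => false, rfl, Or.inl hl⟩

/-- If the machine does not halt, then every heap that starts with the initial stacks of the machine
contains an error. -/
theorem satisfies_errorGraph_of_not_halts (hs : ∀ i x y, H.s i x y ↔ s i x = y)
    (hroot : ∀ i x, s i x ≠ H.root) (hroot₁ : s 0 H.root ≠ H.null) (hroot₂ : s 1 H.root = H.null)
    (hF : ∀ q ∈ F, ∀ o r, M q o = some r → r.1 ∈ F)
    {c : RotaryCfg Q} (hc : c.state = q₀)
    (y : ℕ → H.V) (hy0 : y 0 = s 0 H.root) (hy : ∀ t, y (t + 1) = s 0 (y t))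
    (hinit : ∀ t < 4, Represents s H.null (M.run c t).first (s 1 (y t)))
    (hhalt : ∀ t, M (M.run c t).state (M.run c t).first.head? ≠ none) :
    Satisfies H (errorGraph M q₀) := by
  classical
  have hnull : ∀ i, s i H.null = H.null := fun i => (hs i _ _).1 ((H.null_edge i _).2 rfl)
  by_cases hN : ∃ N, y N = H.null
  swap
  · -- The main path never reaches `null`.
    push Not at hN
    refine satisfies_errorGraph_of_stage hs hroot hroot₁ hroot₂ (fun _ => false) rfl
      (fun x => if ∃ t, y t = x then .cyclic else .off) ?_ ?_ ?_
    · left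
      exact if_pos ⟨0, hy0⟩
    · intro x hx hx0
      by_cases h : ∃ t, y t = x
      · obtain ⟨t, rfl⟩ := h
        exact absurd ((hy t).trans hx0) (hN (t + 1))
      · rw [if_neg h]; trivial
    · intro x hx hx0
      by_cases h : ∃ t, y t = x
      · rw [if_pos h]
        obtain ⟨t, rfl⟩ := h
        exact if_pos ⟨t + 1, hy t⟩
      · rw [if_neg h]; trivial
  obtain ⟨N, hN⟩ := hN
  choose r hr using fun t => Option.ne_none_iff_exists'.1 (hhalt t)
  have hstate : ∀ t, (M.run c t).state ∈ F := by
    intro t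
    induction t with
    | zero => rw [RotaryMachine.run_zero, hc]; exact q₀.2
    | succ t ih => rw [RotaryMachine.run_state (hr t)]; exact hF _ ih _ _ (hr t)
  let q : ℕ → F := fun t => ⟨(M.run c t).state, hstate t⟩
  have hq0 : q 0 = q₀ := Subtype.ext (by simpa [q] using hc)
  have hqsucc : ∀ t, ∃ h : (r t).1 ∈ F, q (t + 1) = ⟨(r t).1, h⟩ := fun t =>
    ⟨hF _ (hstate t) _ _ (hr t), Subtype.ext (RotaryMachine.run_state (hr t))⟩
  have hnext : ∀ t, Represents s H.null (M.run c t).first (s 1 (y t)) →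
      M (q t) (letter s H.null (s 1 (y t))) = some (r t) := fun t h => by
    rw [h.letter_eq]; exact hr t
  by_cases herr : ∃ t, ¬Represents s H.null (M.run c t).first (s 1 (y t)) ∧ y t ≠ H.null
  swap
  · -- All stacks are correct; the colours follow the run, which goes on for ever.
    push Not at herr
    refine satisfies_errorGraph_of_path hs hroot hroot₁ hroot₂ (fun _ => false) rfl y hy0 hy hN
      (fun t => .run (q t)) (by simp [hq0]) (fun _ _ _ => trivial) ?_
    intro t ht
    have hrep : Represents s H.null (M.run c t).first (s 1 (y t)) := by
      by_contra h
      exact ht (by rw [hy, herr t h, hnull])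
    obtain ⟨h, e⟩ := hqsucc t
    exact ⟨r t, hnext t hrep, Or.inl ⟨h, by rw [e]⟩⟩
  -- The first stack that is wrong is at some time `j + 4`, since the initial stacks are correct.
  obtain ⟨⟨hbad, hynull⟩, hmin⟩ := And.intro (Nat.find_spec herr) (@Nat.find_min _ _ herr)
  generalize Nat.find herr = i at hbad hynull hmin
  have hi : 4 ≤ i := by
    by_contra h
    exact hbad (hinit i (by omega))
  obtain ⟨j, rfl⟩ := Nat.exists_eq_add_of_le' hi
  have hynull' : ∀ t ≤ j + 4, y t ≠ H.null := by
    intro t ht h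
    have : ∀ k, y (t + k) = H.null := by
      intro k
      induction k with
      | zero => exact h
      | succ k ih => rw [← add_assoc, hy, ih, hnull]
    exact hynull (by rw [← Nat.add_sub_of_le ht]; exact this _)
  have hrep : ∀ t < j + 4, Represents s H.null (M.run c t).first (s 1 (y t)) := by
    intro t ht
    by_contra h
    exact hmin ht ⟨h, hynull' t ht.le⟩
  rw [RotaryMachine.run_first_add_four (hr j)] at hbad
  obtain ⟨bit, hbit, hviol⟩ := exists_bit_violation (hnull 0) (hrep j (by omega)) _ hbad
  set T := (r j).2.violations ⟨letter s H.null (s 1 (y j)), bit (s 1 (y j)), bit (s 0 (s 1 (y j)))⟩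
    with hT
  let σ : ℕ → Stage F := fun t =>
    if t ≤ j then .run (q t)
    else if t = j + 1 then .wait 3 T
    else if t = j + 2 then .wait 2 T
    else if t = j + 3 then .wait 1 T
    else if t = j + 4 then .wait 0 T
    else .done
  have σle : ∀ t ≤ j, σ t = .run (q t) := fun t ht => if_pos ht
  have σ1 : σ (j + 1) = .wait 3 T := by simp [σ]
  have σ2 : σ (j + 2) = .wait 2 T := by simp [σ]
  have σ3 : σ (j + 3) = .wait 1 T := by simp [σ]
  have σ4 : σ (j + 4) = .wait 0 T := by simp [σ]
  have σdone : ∀ t, j + 4 < t → σ t = .done := fun t ht => by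
    simp only [σ]
    rw [if_neg (by omega), if_neg (by omega), if_neg (by omega), if_neg (by omega),
      if_neg (by omega)]
  refine satisfies_errorGraph_of_path hs hroot hroot₁ hroot₂ bit hbit y hy0 hy hN σ
    (by rw [σle 0 (by omega), hq0]) ?_ ?_
  · intro t ht ht1
    have : j + 4 < t + 1 := by
      by_contra h
      exact hynull' (t + 1) (by omega) ht1
    rcases Nat.lt_or_eq_of_le (Nat.le_of_lt_succ this) with h | h
    · rw [σdone t h]; trivial
    · rw [← h, σ4]
      exact ⟨rfl, hviol⟩
  · intro t ht
    rcases lt_trichotomy t j with h | h | h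
    · obtain ⟨h', e⟩ := hqsucc t
      rw [σle t h.le, σle (t + 1) h]
      exact ⟨r t, hnext t (hrep t (by omega)), Or.inl ⟨h', by rw [e]⟩⟩
    · subst h
      rw [σle t le_rfl, σ1]
      exact ⟨r t, hnext t (hrep t (by omega)), Or.inr rfl⟩
    · rcases (by omega : t = j + 1 ∨ t = j + 2 ∨ t = j + 3 ∨ t = j + 4 ∨ j + 4 < t) with
        rfl | rfl | rfl | rfl | h
      · rw [σ1, σ2]; exact Or.inr ⟨2, rfl, rfl⟩
      · rw [σ2, σ3]; exact Or.inr ⟨1, rfl, rfl⟩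
      · rw [σ3, σ4]; exact Or.inr ⟨0, rfl, rfl⟩
      · rw [σ4, σdone _ (by omega)]; exact Or.inl ⟨rfl, hviol, rfl⟩
      · rw [σdone t h, σdone _ (by omega)]; rfl

end Soundness

/-! ### The heap that records a halting run -/

/-- Candidates for the nodes of the heap that records a run: `root`, the main path with one node
for each time, and a cell for each possible stack, so that equal stacks are shared. The empty stack
serves as `null`. -/
inductive RunNode
  | root
  | main (t : ℕ)
  | cell (l : List Γ')

/-- The edges between these nodes, for a main path with `K` nodes and the stack `L t` at
time `t`. -/
def RunNode.succ (L : ℕ → List Γ') (K : ℕ) (i : Fin 2) : RunNode → RunNode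
  | root => if i = 0 then main 0 else cell []
  | main t => if i = 0 then (if t + 1 < K then main (t + 1) else cell []) else cell (L t)
  | cell [] => cell []
  | cell (a :: l) => if i = 0 then cell l else cell (letterTail a)

/-- Reachability from the root. -/
def RunNode.Reachable (L : ℕ → List Γ') (K : ℕ) (x : RunNode) : Prop :=
  Relation.ReflTransGen (fun y z => ∃ i, RunNode.succ L K i y = z) RunNode.root x

section RunHeap

variable {L : ℕ → List Γ'} {K : ℕ}

theorem RunNode.Reachable.succ {x : RunNode} (h : x.Reachable L K) (i : Fin 2) :
    (RunNode.succ L K i x).Reachable L K :=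
  Relation.ReflTransGen.tail h ⟨i, rfl⟩

theorem RunNode.reachable_nil : (RunNode.cell []).Reachable L K :=
  RunNode.Reachable.succ (x := .root) Relation.ReflTransGen.refl 1

theorem RunNode.reachable_main {t : ℕ} (ht : t < K) :
    (RunNode.main t).Reachable L K := by
  induction t with
  | zero => exact RunNode.Reachable.succ (x := .root) Relation.ReflTransGen.refl 0
  | succ t ih =>
    have := (ih (by omega)).succ 0
    simpa [RunNode.succ, ht] using this

theorem RunNode.succ_cell (a : Fin 2) (l : List Γ') :
    ∃ l', RunNode.succ L K a (.cell l) = .cell l' := by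
  cases l with
  | nil => exact ⟨[], rfl⟩
  | cons b l =>
    simp only [RunNode.succ]
    split_ifs
    exacts [⟨_, rfl⟩, ⟨_, rfl⟩]

theorem RunNode.finite_reachable (hK : 0 < K) : {x : RunNode | x.Reachable L K}.Finite := by
  obtain ⟨m, hm⟩ : ∃ m, ∀ t < K, (L t).length ≤ m :=
    ⟨(Finset.range K).sup fun t => (L t).length, fun t ht =>
      Finset.le_sup (f := fun t => (L t).length) (Finset.mem_range.2 ht)⟩
  have hfin : ({RunNode.root} ∪ RunNode.main '' Set.Iio K ∪
      RunNode.cell '' {l | l.length ≤ m + 1}).Finite :=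
    ((Set.finite_singleton _).union ((Set.finite_Iio K).image _)).union
      ((List.finite_length_le Γ' (m + 1)).image _)
  refine hfin.subset ?_
  intro x hx
  induction hx with
  | refl => simp
  | @tail y z _ hyz ih =>
    obtain ⟨i, rfl⟩ := hyz
    rcases ih with (rfl | ⟨t, ht, rfl⟩) | ⟨l, hl, rfl⟩
    · fin_cases i <;> simp [RunNode.succ, hK]
    · by_cases hi : i = 0
      · by_cases h : t + 1 < K
        · simp [RunNode.succ, hi, h]
        · simp [RunNode.succ, hi, h]
      · simp [RunNode.succ, hi, (hm t ht).trans (Nat.le_succ m)]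
    · refine Or.inr ?_
      cases l with
      | nil => exact ⟨[], by simp, rfl⟩
      | cons a l =>
        by_cases hi : i = 0
        · refine ⟨l, ?_, by simp [RunNode.succ, hi]⟩
          simp only [Set.mem_ofPred_eq, List.length_cons] at hl ⊢
          omega
        · refine ⟨letterTail a, ?_, by simp [RunNode.succ, hi]⟩
          cases a <;> simp [letterTail]

variable (L) in
/-- The heap that records a run: the reachable part of the graph described by `RunNode.succ`. -/
def runHeap (hK : 0 < K) : Graph where
  V := {x : RunNode // x.Reachable L K}
  finite := (RunNode.finite_reachable hK).to_subtype
  s := fun i x y => RunNode.succ L K i x.1 = y.1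
  null := ⟨.cell [], RunNode.reachable_nil⟩
  root := ⟨.root, Relation.ReflTransGen.refl⟩
  root_ne_null h := by simpa using congrArg Subtype.val h
  null_edge := by
    intro i x
    rw [Subtype.ext_iff]
    exact eq_comm

theorem isHeap_runHeap (hK : 0 < K) : IsHeap (runHeap L hK) := by
  refine ⟨fun i x => ⟨⟨_, x.2.succ i⟩, rfl, fun y hy => Subtype.ext hy.symm⟩, ?_⟩
  rintro ⟨x, hx⟩ -
  change Relation.ReflTransGen _ (⟨.root, Relation.ReflTransGen.refl⟩ : (runHeap L hK).V) ⟨x, hx⟩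
  induction hx with
  | refl => exact Relation.ReflTransGen.refl
  | @tail y z hy hyz ih => exact Relation.ReflTransGen.tail ih hyz

variable {Q : Type} {M : RotaryMachine Q} {F : Set Q} [Finite F] {q₀ : F}

/-- The heap that records a halting run contains no error: every colouring of it has to follow the
run, and it can neither continue at the halting configuration nor verify an error. -/
theorem not_satisfies_errorGraph_runHeap {c : RotaryCfg Q} (hc : c.state = q₀) {N : ℕ}
    (hN : M (M.run c N).state (M.run c N).first.head? = none)
    (hlt : ∀ t < N, M (M.run c t).state (M.run c t).first.head? ≠ none) :
    ¬Satisfies (runHeap (fun t => (M.run c t).first) (Nat.succ_pos (N + 3)))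
      (errorGraph M q₀) := by
  classical
  rintro ⟨φ, hedge, hroot, hnull⟩
  generalize hL : (fun t => (M.run c t).first) = L at *
  have hL' : ∀ t, (M.run c t).first = L t := fun t => congrFun hL t
  simp only [hL'] at hN hlt
  set K := N + 3 + 1 with hK
  let col : RunNode → Colour F := fun x => if h : x.Reachable L K then φ ⟨x, h⟩ else .null
  have col_eq : ∀ {x} (h : x.Reachable L K), col x = φ ⟨x, h⟩ := fun h => dif_pos h
  have edge₁ : ∀ {x}, x.Reachable L K →
      Colour.Edge₁ M q₀ (col x) (col (RunNode.succ L K 0 x)) := fun {x} h => by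
    rw [col_eq h, col_eq (h.succ 0)]
    exact hedge 0 ⟨x, h⟩ ⟨_, h.succ 0⟩ rfl
  have edge₂ : ∀ {x}, x.Reachable L K →
      Colour.Edge₂ (col x) (col (RunNode.succ L K 1 x)) := fun {x} h => by
    rw [col_eq h, col_eq (h.succ 1)]
    exact hedge 1 ⟨x, h⟩ ⟨_, h.succ 1⟩ rfl
  have col_nil : col (.cell []) = .null := by
    rw [col_eq RunNode.reachable_nil]
    exact (hnull _).2 rfl
  have col_root : col .root = .root := by
    rw [col_eq Relation.ReflTransGen.refl]
    exact (hroot _).2 rfl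
  have col_node : ∀ {x : RunNode}, x.Reachable L K → x ≠ .root → x ≠ .cell [] →
      ∃ p p' σ, col x = .node p p' σ := by
    intro x hx h1 h2
    rw [col_eq hx]
    match hφ : φ ⟨x, hx⟩ with
    | .null => exact absurd (congrArg Subtype.val ((hnull _).1 hφ)) h2
    | .root => exact absurd (congrArg Subtype.val ((hroot _).1 hφ)) h1
    | .node p p' σ => exact ⟨p, p', σ, rfl⟩
  let P : List Γ' → Profile := fun l => (col (.cell l)).profile
  have P_nil : P [] = .null := by simp only [P, col_nil]; rfl
  have P_cons : ∀ {a l}, (RunNode.cell (a :: l)).Reachable L K →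
      (P (a :: l)).letter = some (nextLetter (P (letterTail a)).letter) ∧
      (P (a :: l)).tailBit = (P l).bit := by
    intro a l h
    obtain ⟨p, p', σ, e⟩ := col_node h (by simp) (by simp)
    have e2 := edge₂ h
    have e1 := edge₁ h
    simp only [RunNode.succ, e, if_true] at e1 e2
    simp only [P, e]
    refine ⟨?_, ?_⟩
    · simp only [one_ne_zero, if_false] at e2
      revert e2
      cases col (.cell (letterTail a)) with
      | root => exact False.elim
      | null => exact fun h => h.2
      | node => exact fun h => h.2
    · revert e1
      cases col (.cell l) with
      | root => exact False.elim
      | null => exact fun h => h.1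
      | node => exact fun h => h.1
  have reach_letterTail : ∀ {a l}, (RunNode.cell (a :: l)).Reachable L K →
      (RunNode.cell (letterTail a)).Reachable L K := fun h => h.succ 1
  -- The letters are determined one after the other, in the order of their unary encodings.
  have P_letter : ∀ {l}, (RunNode.cell l).Reachable L K → (P l).letter = l.head? := by
    have h1 : ∀ {l}, (RunNode.cell (.cons :: l)).Reachable L K →
        (P (.cons :: l)).letter = some .cons := fun h => by
      rw [(P_cons h).1, letterTail, P_nil]; rfl
    have h2 : ∀ {l}, (RunNode.cell (.bit1 :: l)).Reachable L K →
        (P (.bit1 :: l)).letter = some .bit1 := fun h => by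
      rw [(P_cons h).1, letterTail, h1 (reach_letterTail h)]; rfl
    have h3 : ∀ {l}, (RunNode.cell (.bit0 :: l)).Reachable L K →
        (P (.bit0 :: l)).letter = some .bit0 := fun h => by
      rw [(P_cons h).1, letterTail, h2 (reach_letterTail h)]; rfl
    have h4 : ∀ {l}, (RunNode.cell (.consₗ :: l)).Reachable L K →
        (P (.consₗ :: l)).letter = some .consₗ := fun h => by
      rw [(P_cons h).1, letterTail, h3 (reach_letterTail h)]; rfl
    intro l h
    match l with
    | [] => rw [P_nil]; rfl
    | .cons :: _ => exact h1 h
    | .bit1 :: _ => exact h2 h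
    | .bit0 :: _ => exact h3 h
    | .consₗ :: _ => exact h4 h
  have P_tail : ∀ {l}, (RunNode.cell l).Reachable L K → (P l).tailBit = (P l.tail).bit := by
    intro l h
    match l with
    | [] => rw [List.tail_nil, P_nil]; rfl
    | a :: l => exact (P_cons h).2
  have reach_main : ∀ {t}, t < K → (RunNode.main t).Reachable L K := fun ht =>
    RunNode.reachable_main ht
  have reach_stack : ∀ {t}, t < K → (RunNode.cell (L t)).Reachable L K := fun ht =>
    (reach_main ht).succ 1
  have main_node : ∀ {t}, t < K → ∃ p σ, col (.main t) = .node p (P (L t)) σ := by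
    intro t ht
    obtain ⟨p, p', σ, e⟩ := col_node (reach_main ht) (by simp) (by simp)
    have e2 := edge₂ (reach_main ht)
    simp only [RunNode.succ, e, one_ne_zero, if_false] at e2
    have : p' = P (L t) := by
      revert e2
      simp only [P]
      cases col (.cell (L t)) with
      | root => exact False.elim
      | null => exact fun h => h.1
      | node => exact fun h => h.1
    exact ⟨p, σ, by rw [e, this]⟩
  have no_violation : ∀ {t}, t < N → ∀ r, M (M.run c t).state (L t).head? = some r →
      P (L (t + 4)) ∉ r.2.violations (P (L t)) := by
    intro t ht r hr
    have e : L (t + 4) = r.2.apply (L t) := by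
      rw [← hL', ← hL']
      exact RotaryMachine.run_first_add_four (by rw [hL']; exact hr)
    have hreach : (RunNode.cell (L (t + 4))).Reachable L K := reach_stack (by omega)
    have ht' : (RunNode.cell (L t)).Reachable L K := reach_stack (by omega)
    obtain ⟨q, op⟩ := r
    rw [e] at hreach ⊢
    cases op with
    | keep => simp [StackOp.violations, StackOp.apply]
    | pop => simp [StackOp.violations, StackOp.apply, P_tail ht']
    | push a =>
      simp only [StackOp.apply] at hreach
      simp [StackOp.violations, StackOp.apply, P_letter hreach, P_tail hreach]
  -- A colouring either claims cyclicity, or follows the run, or waits to verify an error that it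
  -- has claimed at an earlier step `j`.
  have key : ∀ t < K, ∃ p σ, col (.main t) = .node p (P (L t)) σ ∧
      (σ = .cyclic ∨ (t ≤ N ∧ ∃ h, σ = .run ⟨(M.run c t).state, h⟩) ∨
        ∃ j < N, ∃ r, M (M.run c j).state (L j).head? = some r ∧
          ∃ n : Fin 4, t + n = j + 4 ∧ σ = .wait n (r.2.violations (P (L j)))) := by
    intro t
    induction t with
    | zero =>
      intro ht
      obtain ⟨p, σ, e⟩ := main_node ht
      refine ⟨p, σ, e, ?_⟩
      have e1 := edge₁ (x := .root) Relation.ReflTransGen.refl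
      simp only [RunNode.succ, if_true, col_root, e] at e1
      rcases e1 with h | h
      · exact Or.inl h
      · refine Or.inr (Or.inl ⟨Nat.zero_le _, ?_, ?_⟩)
        · rw [RotaryMachine.run_zero, hc]; exact q₀.2
        · rw [h]; congr 1; exact Subtype.ext hc.symm
    | succ t ih =>
      intro ht
      obtain ⟨p, σ, e, hσ⟩ := ih (by omega)
      obtain ⟨p', τ, e'⟩ := main_node ht
      refine ⟨p', τ, e', ?_⟩
      have e1 := edge₁ (reach_main (show t < K by omega))
      simp only [RunNode.succ, if_true, ht, e, e'] at e1
      replace e1 := e1.2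
      rcases hσ with rfl | ⟨htN, hF, rfl⟩ | ⟨j, hj, r, hr, n, hn, rfl⟩
      · exact Or.inl e1
      · obtain ⟨r, hr, h⟩ := e1
        rw [P_letter (reach_stack (by omega))] at hr
        have htN' : t < N := by
          rcases Nat.lt_or_eq_of_le htN with h | rfl
          · exact h
          · rw [hN] at hr; cases hr
        rcases h with ⟨h, rfl⟩ | rfl
        · have hst : (M.run c (t + 1)).state = r.1 :=
            RotaryMachine.run_state (by rw [hL']; exact hr)
          exact Or.inr (Or.inl ⟨htN', hst ▸ h, by congr 1; exact Subtype.ext hst.symm⟩)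
        · exact Or.inr (Or.inr ⟨t, htN', r, hr, 3, rfl, rfl⟩)
      · rcases e1 with ⟨rfl, h, -⟩ | ⟨m, hm, rfl⟩
        · obtain rfl : t = j + 4 := by simpa using hn
          exact absurd h (no_violation hj r hr)
        · exact Or.inr (Or.inr ⟨j, hj, r, hr, m, by omega, rfl⟩)
  -- The last node of the main path is followed by `null`, which none of the three cases permits.
  obtain ⟨p, σ, e, hσ⟩ := key (N + 3) (by omega)
  have e1 := edge₁ (reach_main (show N + 3 < K by omega))
  simp only [RunNode.succ, if_true, e, ← hK, lt_irrefl, if_false, col_nil] at e1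
  replace e1 := e1.2
  rcases hσ with rfl | ⟨htN, -⟩ | ⟨j, hj, r, hr, n, hn, rfl⟩
  · exact e1
  · omega
  · obtain ⟨rfl, h⟩ := e1
    have : N + 3 = j + 4 := by simpa using hn
    rw [this] at h
    exact no_violation hj r hr h

end RunHeap

/-! ### Simulation of multi-stack machines -/

section Simulation

open Turing Turing.PartrecToTM2 StateTransition

/-- The order in which the stacks are arranged. -/
def stackName : Fin 4 → K'
  | 0 => .main
  | 1 => .rev
  | 2 => .aux
  | 3 => .stack

/-- The states of the simulating machine: the index of the first stack of the queue, the statement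
that remains to be executed, and the internal state. -/
abbrev SimState : Type := Fin 4 × Stmt' × Option Γ'

open Classical in
/-- The machine that simulates the program `tr` statement by statement. If a statement concerns a
stack other than the first one, then the machine only rotates its stacks. -/
noncomputable def simulator : RotaryMachine SimState
  | (k, .push k' f q, v), _ =>
    if stackName k = k' then some ((k + 1, q, v), .push (f v))
    else some ((k + 1, .push k' f q, v), .keep)
  | (k, .peek k' f q, v), o =>
    if stackName k = k' then some ((k + 1, q, f v o), .keep)
    else some ((k + 1, .peek k' f q, v), .keep)
  | (k, .pop k' f q, v), o =>
    if stackName k = k' then some ((k + 1, q, f v o), .pop)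
    else some ((k + 1, .pop k' f q, v), .keep)
  | (k, .load a q, v), _ => some ((k + 1, q, a v), .keep)
  | (k, .branch p q₁ q₂, v), _ => some ((k + 1, cond (p v) q₁ q₂, v), .keep)
  | (k, .goto l, v), _ => some ((k + 1, tr (l v), v), .keep)
  | (_, .halt, _), _ => none

/-- The configuration of the simulator with stacks `S`, the first one of the queue having
index `k`. -/
def simCfg (k : Fin 4) (q : Stmt') (v : Option Γ') (S : K' → List Γ') : RotaryCfg SimState :=
  ⟨(k, q, v), S (stackName k), S (stackName (k + 1)), S (stackName (k + 2)), S (stackName (k + 3))⟩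

theorem step_simCfg {k : Fin 4} {q q' : Stmt'} {v v' : Option Γ'} {S : K' → List Γ'} {op : StackOp}
    (h : simulator (k, q, v) (S (stackName k)).head? = some ((k + 1, q', v'), op)) :
    simCfg (k + 1) q' v' (Function.update S (stackName k) (op.apply (S (stackName k)))) ∈
      simulator.step (simCfg k q v S) := by
  simp only [RotaryMachine.step, simCfg, h, Option.map_some, Option.mem_def]
  fin_cases k <;> rfl

theorem step_simCfg_keep {k : Fin 4} {q q' : Stmt'} {v v' : Option Γ'} {S : K' → List Γ'}
    (h : simulator (k, q, v) (S (stackName k)).head? = some ((k + 1, q', v'), .keep)) :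
    simCfg (k + 1) q' v' S ∈ simulator.step (simCfg k q v S) := by
  simpa [StackOp.apply] using step_simCfg h

/-- A statement that waits for the stack `k'` is reached with that stack in front. -/
theorem reaches_stackName {q : Stmt'} {v : Option Γ'} (S : K' → List Γ') {k' : K'}
    (h : ∀ k o, stackName k ≠ k' → simulator (k, q, v) o = some ((k + 1, q, v), .keep))
    (k : Fin 4) :
    ∃ k₁, stackName k₁ = k' ∧ Reaches simulator.step (simCfg k q v S) (simCfg k₁ q v S) := by
  have hk' : ∃ n : ℕ, stackName (k + Fin.ofNat 4 n) = k' := by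
    obtain ⟨k₀, rfl⟩ : ∃ k₀, stackName k₀ = k' := by
      cases k'
      exacts [⟨0, rfl⟩, ⟨1, rfl⟩, ⟨2, rfl⟩, ⟨3, rfl⟩]
    exact ⟨(k₀ - k).val, by simp⟩
  obtain ⟨n, hn⟩ := hk'
  induction n generalizing k with
  | zero => exact ⟨k, by simpa using hn, Relation.ReflTransGen.refl⟩
  | succ n ih =>
    by_cases hk : stackName k = k'
    · exact ⟨k, hk, Relation.ReflTransGen.refl⟩
    · obtain ⟨k₁, h1, h2⟩ := ih (k + 1) (by
        rw [← hn]; congr 1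
        have : Fin.ofNat 4 (n + 1) = Fin.ofNat 4 n + 1 := by
          apply Fin.ext; simp [Fin.val_add]
        rw [this, add_assoc, add_comm 1])
      exact ⟨k₁, h1, Relation.ReflTransGen.head (step_simCfg_keep (h k _ hk)) h2⟩

/-- The relation between the configurations of the program and of the simulator. A label `l` is
represented by any jump that leads to `l`. -/
def SimRel (c : Cfg') (d : RotaryCfg SimState) : Prop :=
  ∃ k q, d = simCfg k q c.var c.stk ∧
    ((c.l = none ∧ q = .halt) ∨ ∃ f, c.l = some (f c.var) ∧ q = .goto f)

/-- The simulator carries out a whole statement of the program. It need not move if the statement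
is a jump, which is why labels are represented by jumps and not by the statements there. -/
theorem exists_reaches_stepAux (q : Stmt') (k : Fin 4) (v : Option Γ') (S : K' → List Γ') :
    ∃ d, SimRel (TM2.stepAux q v S) d ∧ Reaches simulator.step (simCfg k q v S) d := by
  induction q generalizing k v S with
  | push k' f q ih =>
    obtain ⟨k₁, rfl, h1⟩ := reaches_stackName (q := .push k' f q) (v := v) (k' := k') S
      (fun k o hk => by simp [simulator, hk]) k
    obtain ⟨d, h2, h3⟩ := ih (k₁ + 1) v _
    exact ⟨d, h2, (h1.tail (step_simCfg (op := .push (f v)) (by simp [simulator]))).trans h3⟩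
  | peek k' f q ih =>
    obtain ⟨k₁, rfl, h1⟩ := reaches_stackName (q := .peek k' f q) (v := v) (k' := k') S
      (fun k o hk => by simp [simulator, hk]) k
    obtain ⟨d, h2, h3⟩ := ih (k₁ + 1) _ S
    exact ⟨d, h2, (h1.tail (step_simCfg_keep (by simp [simulator]))).trans h3⟩
  | pop k' f q ih =>
    obtain ⟨k₁, rfl, h1⟩ := reaches_stackName (q := .pop k' f q) (v := v) (k' := k') S
      (fun k o hk => by simp [simulator, hk]) k
    obtain ⟨d, h2, h3⟩ := ih (k₁ + 1) _ _
    exact ⟨d, h2, (h1.tail (step_simCfg (op := .pop) (by simp [simulator]))).trans h3⟩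
  | load a q ih =>
    obtain ⟨d, h2, h3⟩ := ih (k + 1) (a v) S
    exact ⟨d, h2, Relation.ReflTransGen.head (step_simCfg_keep (by simp [simulator])) h3⟩
  | branch p q₁ q₂ ih₁ ih₂ =>
    rw [TM2.stepAux]
    cases hp : p v
    · obtain ⟨d, h2, h3⟩ := ih₂ (k + 1) v S
      exact ⟨d, h2, Relation.ReflTransGen.head (step_simCfg_keep (by rw [simulator, hp]; rfl)) h3⟩
    · obtain ⟨d, h2, h3⟩ := ih₁ (k + 1) v S
      exact ⟨d, h2, Relation.ReflTransGen.head (step_simCfg_keep (by rw [simulator, hp]; rfl)) h3⟩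
  | goto l => exact ⟨_, ⟨k, _, rfl, Or.inr ⟨l, rfl, rfl⟩⟩, Relation.ReflTransGen.refl⟩
  | halt => exact ⟨_, ⟨k, _, rfl, Or.inl ⟨rfl, rfl⟩⟩, Relation.ReflTransGen.refl⟩

theorem simulator_respects : Respects (TM2.step tr) simulator.step SimRel := by
  rintro ⟨l, v, S⟩ d ⟨k, q, rfl, ⟨hl, rfl⟩ | ⟨f, hl, rfl⟩⟩
  · obtain rfl : l = none := hl
    rfl
  · obtain rfl : l = some (f v) := hl
    obtain ⟨d, h1, h2⟩ := exists_reaches_stepAux (tr (f v)) (k + 1) v S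
    exact ⟨d, h1, Relation.TransGen.head' (step_simCfg_keep (by simp [simulator])) h2⟩

/-- The initial configuration of the simulator. -/
def simInit (c : ToPartrec.Code) (v : List ℕ) : RotaryCfg SimState :=
  ⟨(0, .goto fun _ => trNormal c .halt, none), trList v, [], [], []⟩

theorem simulator_eval_dom (c : ToPartrec.Code) (v : List ℕ) :
    (eval simulator.step (simInit c v)).Dom ↔ (c.eval v).Dom := by
  have h := tr_eval_dom simulator_respects (a₁ := init c v) (a₂ := simInit c v)
    ⟨0, _, rfl, Or.inr ⟨fun _ => trNormal c .halt, rfl, rfl⟩⟩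
  rw [h, PartrecToTM2.tr_eval]
  rfl

/-- The states that the simulator can visit when it runs the program of the code `c`. -/
def simStates (c : ToPartrec.Code) : Set SimState :=
  {x | x.2.1 = (.goto fun _ => trNormal c .halt) ∨
    some x.2.1 ∈ TM2.stmts tr (codeSupp c .halt)}

instance (c : ToPartrec.Code) : Finite (simStates c) := by
  have h : {q : Stmt' | q = (.goto fun _ => trNormal c .halt) ∨
      some q ∈ TM2.stmts tr (codeSupp c .halt)}.Finite :=
    (Set.finite_singleton _).union
      ((Finset.finite_toSet _).preimage (Option.some_injective _).injOn)
  refine Set.Finite.to_subtype (((Set.finite_univ.prod (h.prod Set.finite_univ))).subset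
    (s := (Set.univ : Set (Fin 4)) ×ˢ (_ ×ˢ (Set.univ : Set (Option Γ')))) ?_)
  rintro ⟨k, q, v⟩ hx
  exact ⟨trivial, hx, trivial⟩

theorem simInit_state_mem (c : ToPartrec.Code) (v : List ℕ) :
    (simInit c v).state ∈ simStates c := Or.inl rfl

theorem simStates_closed (c : ToPartrec.Code) :
    ∀ x ∈ simStates c, ∀ o r, simulator x o = some r → r.1 ∈ simStates c := by
  classical
  have hsupp := tr_supports c .halt
  have hlabel : ∀ l ∈ codeSupp c .halt, some (tr l) ∈ TM2.stmts tr (codeSupp c .halt) :=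
    fun l hl => Finset.some_mem_insertNone.2 (Finset.mem_biUnion.2 ⟨l, hl, TM2.stmts₁_self⟩)
  rintro ⟨k, q, v⟩ hx o r hr
  rcases hx with hx | hx
  · obtain rfl : q = _ := hx
    simp only [simulator, Option.some.injEq] at hr
    subst hr
    exact Or.inr (hlabel _ hsupp.1)
  · have hsub : ∀ q', q' ∈ TM2.stmts₁ q → some q' ∈ TM2.stmts tr (codeSupp c .halt) :=
      fun q' h => TM2.stmts_trans h hx
    cases q with
    | push k' f q =>
      simp only [simulator] at hr
      split_ifs at hr <;> cases hr
      · exact Or.inr (hsub _ (by simp [TM2.stmts₁, TM2.stmts₁_self]))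
      · exact Or.inr hx
    | peek k' f q =>
      simp only [simulator] at hr
      split_ifs at hr <;> cases hr
      · exact Or.inr (hsub _ (by simp [TM2.stmts₁, TM2.stmts₁_self]))
      · exact Or.inr hx
    | pop k' f q =>
      simp only [simulator] at hr
      split_ifs at hr <;> cases hr
      · exact Or.inr (hsub _ (by simp [TM2.stmts₁, TM2.stmts₁_self]))
      · exact Or.inr hx
    | load a q =>
      cases hr
      exact Or.inr (hsub _ (by simp [TM2.stmts₁, TM2.stmts₁_self]))
    | branch p q₁ q₂ =>
      cases hr
      refine Or.inr (hsub _ ?_)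
      cases p v
      · exact Finset.mem_insert_of_mem (Finset.mem_union_right _ TM2.stmts₁_self)
      · exact Finset.mem_insert_of_mem (Finset.mem_union_left _ TM2.stmts₁_self)
    | goto l =>
      cases hr
      have : TM2.SupportsStmt (codeSupp c .halt) (.goto l) :=
        @TM2.stmts_supportsStmt _ _ _ _ ⟨trNormal c .halt⟩ _ _ _ hsupp hx
      exact Or.inr (hlabel _ (this v))
    | halt => cases hr

end Simulation

/-! ### The input graph -/

/-- The contents of the main stack for the input `2 ^ n - 1`: its `n` binary digits, all of them
`1`, and an end mark. -/
def inputWord (n : ℕ) : List Γ' := List.replicate n .bit1 ++ [.cons]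

theorem trList_two_pow_sub_one (n : ℕ) :
    Turing.PartrecToTM2.trList [2 ^ n - 1] = inputWord n := by
  have key : Turing.PartrecToTM2.trNat (2 ^ n - 1) = List.replicate n .bit1 := by
    induction n with
    | zero => simp
    | succ n ih =>
      have hcast : ((2 ^ (n + 1) - 1 : ℕ) : Num) = Num.bit1 ((2 ^ n - 1 : ℕ) : Num) := by
        apply Num.to_nat_inj.1
        rw [Num.cast_bit1, Num.to_of_nat, Num.to_of_nat, pow_succ]
        have := Nat.one_le_two_pow (n := n)
        omega
      have hbit : ∀ x : Num, Turing.PartrecToTM2.trNum x.bit1 =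
          .bit1 :: Turing.PartrecToTM2.trNum x := by
        rintro (_ | _) <;> rfl
      rw [Turing.PartrecToTM2.trNat, hcast, hbit, List.replicate_succ, ← ih]
      rfl
  simp [inputWord, key]

/-- The edges of the input graph with label `i`: node `2` is unconstrained, the nodes `3, …, 6`
start the main path, and node `7 + j` is the cell of the stack `inputWord j`. Node `7`, the cell of
the stack `[cons]`, is also the target of the second edge of each cell with letter `bit1`. There are
no edges to `root`. -/
def inputEdges (n : ℕ) (i : Fin 2) : List (ℕ × ℕ) :=
  (if i = 0 then [(1, 3), (3, 4), (4, 5), (5, 6), (6, 0), (6, 2), (7, 0), (2, 0)]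
    else [(1, 0), (3, 7 + n), (4, 0), (5, 0), (6, 0), (7, 0), (2, 0)]) ++
  ((List.range n).map (fun j => (8 + j, if i = 0 then 7 + j else 7)) ++
  (List.range (n + 6)).map (fun j => (2, j + 2)))

/-- The graph that forces the first four stacks of the main path to be the initial stacks of the
simulator on the input `2 ^ n - 1`. -/
def inputCode (n : ℕ) : GraphCode := (n + 6, inputEdges n 0, inputEdges n 1)

theorem inputCode_edges (n : ℕ) (i : Fin 2) :
    GraphCode.edges (inputCode n) i = inputEdges n i := by
  fin_cases i <;> rfl

theorem mem_inputEdges_zero {n a b : ℕ} : (a, b) ∈ inputEdges n 0 ↔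
    (a = 1 ∧ b = 3) ∨ (a = 3 ∧ b = 4) ∨ (a = 4 ∧ b = 5) ∨ (a = 5 ∧ b = 6) ∨ (a = 6 ∧ b = 0) ∨
    (a = 6 ∧ b = 2) ∨ (a = 7 ∧ b = 0) ∨ (a = 2 ∧ b = 0) ∨ (8 ≤ a ∧ a < 8 + n ∧ b + 1 = a) ∨
    (a = 2 ∧ 2 ≤ b ∧ b < n + 8) := by
  have h1 : (∃ j < n, 8 + j = a ∧ 7 + j = b) ↔ (8 ≤ a ∧ a < 8 + n ∧ b + 1 = a) :=
    ⟨by rintro ⟨j, h⟩; omega, fun h => ⟨a - 8, by omega⟩⟩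
  have h2 : (∃ j < n + 6, 2 = a ∧ j + 2 = b) ↔ (a = 2 ∧ 2 ≤ b ∧ b < n + 8) :=
    ⟨by rintro ⟨j, h⟩; omega, fun h => ⟨b - 2, by omega⟩⟩
  rw [← h1, ← h2]
  simp [inputEdges]

theorem mem_inputEdges_one {n a b : ℕ} : (a, b) ∈ inputEdges n 1 ↔
    (a = 1 ∧ b = 0) ∨ (a = 3 ∧ b = 7 + n) ∨ (a = 4 ∧ b = 0) ∨ (a = 5 ∧ b = 0) ∨
    (a = 6 ∧ b = 0) ∨ (a = 7 ∧ b = 0) ∨ (a = 2 ∧ b = 0) ∨ (8 ≤ a ∧ a < 8 + n ∧ b = 7) ∨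
    (a = 2 ∧ 2 ≤ b ∧ b < n + 8) := by
  have h1 : (∃ j < n, 8 + j = a ∧ 7 = b) ↔ (8 ≤ a ∧ a < 8 + n ∧ b = 7) :=
    ⟨by rintro ⟨j, h⟩; omega, fun h => ⟨a - 8, by omega⟩⟩
  have h2 : (∃ j < n + 6, 2 = a ∧ j + 2 = b) ↔ (a = 2 ∧ 2 ≤ b ∧ b < n + 8) :=
    ⟨by rintro ⟨j, h⟩; omega, fun h => ⟨b - 2, by omega⟩⟩
  rw [← h1, ← h2]
  simp [inputEdges]

theorem primrec_inputCode : Primrec inputCode := by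
  have h2 : Primrec fun n : ℕ => (List.range (n + 6)).map (fun j => (2, j + 2)) :=
    Primrec.list_map (Primrec.list_range.comp (Primrec.nat_add.comp .id (.const 6)))
      (Primrec.pair (.const 2) (Primrec.nat_add.comp .snd (.const 2)))
  have h1 : ∀ i : Fin 2, Primrec fun n : ℕ =>
      (List.range n).map (fun j => (8 + j, if i = 0 then 7 + j else 7)) := by
    intro i
    refine Primrec.list_map Primrec.list_range
      (Primrec.pair (Primrec.nat_add.comp (.const 8) .snd) ?_)
    by_cases hi : i = 0
    · simpa only [hi, if_true] using Primrec.nat_add.comp (.const 7) .snd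
    · simpa only [hi, if_false] using Primrec.const 7
  refine Primrec.pair (Primrec.nat_add.comp .id (.const 6)) (Primrec.pair ?_ ?_)
  · exact Primrec.list_append.comp (.const _) (Primrec.list_append.comp (h1 0) h2)
  · refine Primrec.list_append.comp ?_ (Primrec.list_append.comp (h1 1) h2)
    simp only [one_ne_zero, if_false]
    exact Primrec.list_cons.comp (.const _) (Primrec.list_cons.comp
      (Primrec.pair (.const 3) (Primrec.nat_add.comp (.const 7) .id)) (.const _))

/-- What the homomorphism into the input graph says about a heap. -/
theorem initial_of_satisfies_inputCode {H : Graph} {s : Fin 2 → H.V → H.V}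
    (hs : ∀ i x y, H.s i x y ↔ s i x = y) {n : ℕ}
    (h : Satisfies H (GraphCode.toGraph (inputCode n))) :
    (∀ i x, s i x ≠ H.root) ∧ s 0 H.root ≠ H.null ∧ s 1 H.root = H.null ∧
      Represents s H.null (inputWord n) (s 1 (s 0 H.root)) ∧
      s 1 (s 0 (s 0 H.root)) = H.null ∧ s 1 (s 0 (s 0 (s 0 H.root))) = H.null ∧
      s 1 (s 0 (s 0 (s 0 (s 0 H.root)))) = H.null := by
  obtain ⟨ψ, hedge, hφroot, hφnull⟩ := h
  let φ : H.V → Fin (n + 6 + 2) := ψ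
  have hsnull : ∀ i, s i H.null = H.null := fun i => (hs i _ _).1 ((H.null_edge i _).2 rfl)
  let g : H.V → ℕ := fun x => (φ x).val
  have gnull : ∀ x, g x = 0 ↔ x = H.null := fun x =>
    (Fin.ext_iff (b := (0 : Fin (n + 6 + 2)))).symm.trans (hφnull x)
  have groot : ∀ x, g x = 1 ↔ x = H.root := fun x =>
    (Fin.ext_iff (b := (1 : Fin (n + 6 + 2)))).symm.trans (hφroot x)
  have gedge : ∀ i x, g x ≠ 0 → (g x, g (s i x)) ∈ inputEdges n i := by
    intro i x hx
    have h := hedge i x (s i x) ((hs i _ _).2 rfl)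
    change if φ x = 0 then φ (s i x) = 0 else
      ((φ x : ℕ), (φ (s i x) : ℕ)) ∈ GraphCode.edges (inputCode n) i at h
    rw [if_neg (fun h0 => hx (congrArg Fin.val h0)), inputCode_edges] at h
    exact h
  have e0 := fun x hx => mem_inputEdges_zero.1 (gedge 0 x hx)
  have e1 := fun x hx => mem_inputEdges_one.1 (gedge 1 x hx)
  have hword : ∀ j ≤ n, ∀ x, g x = 7 + j → Represents s H.null (inputWord j) x := by
    intro j
    induction j with
    | zero =>
      intro _ x hx
      have h0 : s 0 x = H.null := (gnull _).1 (by have := e0 x (by omega); omega)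
      have h1 : s 1 x = H.null := (gnull _).1 (by have := e1 x (by omega); omega)
      have hne : x ≠ H.null := fun h => by have := (gnull x).2 h; omega
      refine ⟨?_, h0⟩
      rw [letter_of_ne s hne, h1, letter_null]
      rfl
    | succ j ih =>
      intro hj x hx
      have h0 : g (s 0 x) = 7 + j := by have := e0 x (by omega); omega
      have h1 : g (s 1 x) = 7 := by have := e1 x (by omega); omega
      have h2 : s 1 (s 1 x) = H.null :=
        (gnull _).1 (by have := e1 (s 1 x) (by omega); omega)
      have hne : x ≠ H.null := fun h => by have := (gnull x).2 h; omega
      have hne1 : s 1 x ≠ H.null := fun h => by have := (gnull _).2 h; omega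
      refine ⟨?_, ih (by omega) _ h0⟩
      rw [letter_of_ne s hne, letter_of_ne s hne1, h2, letter_null]
      rfl
  have r := (groot H.root).2 rfl
  have y0 : g (s 0 H.root) = 3 := by have := e0 H.root (by omega); omega
  have y1 : g (s 0 (s 0 H.root)) = 4 := by have := e0 (s 0 H.root) (by omega); omega
  have y2 : g (s 0 (s 0 (s 0 H.root))) = 5 := by
    have := e0 (s 0 (s 0 H.root)) (by omega); omega
  have y3 : g (s 0 (s 0 (s 0 (s 0 H.root)))) = 6 := by
    have := e0 (s 0 (s 0 (s 0 H.root))) (by omega); omega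
  refine ⟨?_, ?_, ?_, hword n le_rfl _ ?_, ?_, ?_, ?_⟩
  · intro i x hx
    have h1 := (groot _).2 hx
    by_cases h0 : g x = 0
    · rw [(gnull x).1 h0, hsnull] at hx
      exact H.root_ne_null hx.symm
    · obtain rfl | rfl : i = 0 ∨ i = 1 := by omega
      · have := e0 x h0
        omega
      · have := e1 x h0
        omega
  · intro h
    have := (gnull _).2 h
    omega
  · exact (gnull _).1 (by have := e1 H.root (by omega); omega)
  · have := e1 (s 0 H.root) (by omega); omega
  · exact (gnull _).1 (by have := e1 (s 0 (s 0 H.root)) (by omega); omega)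
  · exact (gnull _).1 (by have := e1 (s 0 (s 0 (s 0 H.root))) (by omega); omega)
  · exact (gnull _).1 (by have := e1 (s 0 (s 0 (s 0 (s 0 H.root)))) (by omega); omega)

open Classical in
/-- The homomorphism from a recorded run to the input graph. Cells that do not belong to the initial
stack are unconstrained. -/
noncomputable def inputColour (n : ℕ) : RunNode → ℕ
  | .root => 1
  | .main t => if t < 4 then 3 + t else 2
  | .cell l => if l = [] then 0 else
      if l = inputWord (l.length - 1) ∧ l.length ≤ n + 1 then l.length + 6 else 2

theorem inputColour_main (n t : ℕ) :
    (t < 4 ∧ inputColour n (.main t) = 3 + t) ∨ (4 ≤ t ∧ inputColour n (.main t) = 2) := by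
  by_cases h : t < 4
  · exact Or.inl ⟨h, if_pos h⟩
  · exact Or.inr ⟨by omega, if_neg h⟩

theorem inputColour_inputWord {n j : ℕ} (h : j ≤ n) :
    inputColour n (.cell (inputWord j)) = 7 + j := by
  have : (inputWord j).length = j + 1 := by simp [inputWord]
  have hne : inputWord j ≠ [] := by simp [inputWord]
  rw [inputColour, if_neg hne, if_pos ⟨by rw [this]; rfl, by omega⟩]
  omega

theorem inputColour_cell (n : ℕ) (l : List Γ') :
    (l = [] ∧ inputColour n (.cell l) = 0) ∨ (∃ j ≤ n, l = inputWord j) ∨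
      (l ≠ [] ∧ inputColour n (.cell l) = 2) := by
  by_cases h : l = []
  · exact Or.inl ⟨h, by simp [inputColour, h]⟩
  · by_cases h' : l = inputWord (l.length - 1) ∧ l.length ≤ n + 1
    · exact Or.inr (Or.inl ⟨l.length - 1, by omega, h'.1⟩)
    · exact Or.inr (Or.inr ⟨h, by rw [inputColour, if_neg h, if_neg h']⟩)

theorem inputColour_cell_range (n : ℕ) (l : List Γ') :
    inputColour n (.cell l) = 0 ∨
      (2 ≤ inputColour n (.cell l) ∧ inputColour n (.cell l) < n + 8) := by
  rcases inputColour_cell n l with ⟨-, h⟩ | ⟨j, hj, rfl⟩ | ⟨-, h⟩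
  · exact Or.inl h
  · rw [inputColour_inputWord hj]; omega
  · omega

theorem inputColour_edge {L : ℕ → List Γ'} {K n : ℕ} (hK4 : 4 ≤ K)
    (h0 : L 0 = inputWord n) (h1 : L 1 = []) (h2 : L 2 = []) (h3 : L 3 = []) (i : Fin 2)
    (x : RunNode) (hx : inputColour n x ≠ 0) :
    (inputColour n x, inputColour n (RunNode.succ L K i x)) ∈ inputEdges n i := by
  have hnil : inputColour n (.cell []) = 0 := by simp [inputColour]
  have hcons0 : ∀ a l, RunNode.succ L K 0 (.cell (a :: l)) = .cell l := fun a l => by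
    simp [RunNode.succ]
  have hcons1 : ∀ a l, RunNode.succ L K 1 (.cell (a :: l)) = .cell (letterTail a) := fun a l => by
    simp [RunNode.succ]
  rcases x with _ | t | l
  · obtain rfl | rfl : i = 0 ∨ i = 1 := by omega
    · exact mem_inputEdges_zero.2 (Or.inl ⟨rfl, by simp [RunNode.succ, inputColour]⟩)
    · exact mem_inputEdges_one.2 (Or.inl ⟨rfl, by simp [RunNode.succ, inputColour]⟩)
  · obtain rfl | rfl : i = 0 ∨ i = 1 := by omega
    · refine mem_inputEdges_zero.2 ?_
      by_cases ht : t + 1 < K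
      · have e : RunNode.succ L K 0 (.main t) = .main (t + 1) := by simp [RunNode.succ, ht]
        rw [e]
        rcases inputColour_main n t with ⟨h4, e4⟩ | ⟨h4, e4⟩
        · rcases inputColour_main n (t + 1) with ⟨h5, e5⟩ | ⟨h5, e5⟩
          · rw [e4, e5]; omega
          · rw [e4, e5]; omega
        · rw [e4, (inputColour_main n (t + 1)).resolve_left (by omega) |>.2]; omega
      · have e : RunNode.succ L K 0 (.main t) = .cell [] := by simp [RunNode.succ, ht]
        rw [e, hnil]
        rcases inputColour_main n t with ⟨h4, e4⟩ | ⟨-, e4⟩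
        · obtain rfl : t = 3 := by omega
          simp [e4]
        · simp [e4]
    · refine mem_inputEdges_one.2 ?_
      have e : RunNode.succ L K 1 (.main t) = .cell (L t) := by simp [RunNode.succ]
      simp only [e]
      rcases t with _ | _ | _ | _ | t
      · rw [h0, inputColour_inputWord le_rfl]; simp [inputColour]
      · rw [h1, hnil]; simp [inputColour]
      · rw [h2, hnil]; simp [inputColour]
      · rw [h3, hnil]; simp [inputColour]
      · have e2 : inputColour n (.main (t + 1 + 1 + 1 + 1)) = 2 := by simp [inputColour]
        rw [e2]
        have := inputColour_cell_range n (L (t + 1 + 1 + 1 + 1))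
        omega
  · rcases inputColour_cell n l with ⟨-, h⟩ | ⟨j, hj, rfl⟩ | ⟨hl, h⟩
    · exact absurd h hx
    · rw [inputColour_inputWord hj]
      rcases j with _ | j
      · have e : inputWord 0 = .cons :: [] := rfl
        obtain rfl | rfl : i = 0 ∨ i = 1 := by omega
        · refine mem_inputEdges_zero.2 ?_
          rw [e, hcons0, hnil]; omega
        · refine mem_inputEdges_one.2 ?_
          rw [e, hcons1, letterTail, hnil]; omega
      · have e : inputWord (j + 1) = .bit1 :: inputWord j := rfl
        obtain rfl | rfl : i = 0 ∨ i = 1 := by omega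
        · refine mem_inputEdges_zero.2 ?_
          simp only [e, hcons0, inputColour_inputWord (show j ≤ n by omega)]
          omega
        · refine mem_inputEdges_one.2 ?_
          have e' : inputColour n (.cell [.cons]) = 7 := inputColour_inputWord (Nat.zero_le n)
          rw [e, hcons1, letterTail, e']; omega
    · rw [h]
      obtain ⟨l', hl'⟩ := RunNode.succ_cell (L := L) (K := K) i l
      rw [hl']
      have := inputColour_cell_range n l'
      obtain rfl | rfl : i = 0 ∨ i = 1 := by omega
      · exact mem_inputEdges_zero.2 (by omega)
      · exact mem_inputEdges_one.2 (by omega)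

theorem satisfies_inputCode_runHeap {L : ℕ → List Γ'} {K n : ℕ} (hK : 0 < K) (hK4 : 4 ≤ K)
    (h0 : L 0 = inputWord n) (h1 : L 1 = []) (h2 : L 2 = []) (h3 : L 3 = []) :
    Satisfies (runHeap L hK) (GraphCode.toGraph (inputCode n)) := by
  have hlt : ∀ x, inputColour n x < n + 6 + 2 := by
    rintro (_ | t | l)
    · simp [inputColour]
    · have := inputColour_main n t; omega
    · have := inputColour_cell_range n l; omega
  have hnil : inputColour n (.cell []) = 0 := by simp [inputColour]
  have hnull : ∀ x, inputColour n x = 0 ↔ x = .cell [] := by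
    rintro (_ | t | l)
    · simp [inputColour]
    · have := inputColour_main n t
      simp only [reduceCtorEq, iff_false]; omega
    · rcases inputColour_cell n l with ⟨rfl, h⟩ | ⟨j, hj, rfl⟩ | ⟨hl, h⟩
      · simp [h]
      · rw [inputColour_inputWord hj]; simp [inputWord]
      · simp [h, hl]
  have hroot : ∀ x, inputColour n x = 1 ↔ x = .root := by
    rintro (_ | t | l)
    · simp [inputColour]
    · have := inputColour_main n t
      simp only [reduceCtorEq, iff_false]; omega
    · have := inputColour_cell_range n l
      simp only [reduceCtorEq, iff_false]; omega
  refine ⟨fun x => (⟨inputColour n x.1, hlt x.1⟩ : Fin (n + 6 + 2)), ?_, ?_, ?_⟩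
  · rintro i ⟨x, hx⟩ ⟨y, hy⟩ hxy
    obtain rfl : RunNode.succ L K i x = y := hxy
    change if (⟨inputColour n x, hlt x⟩ : Fin (n + 6 + 2)) = 0 then
      (⟨inputColour n (RunNode.succ L K i x), hlt _⟩ : Fin (n + 6 + 2)) = 0 else
      (inputColour n x, inputColour n (RunNode.succ L K i x)) ∈ GraphCode.edges (inputCode n) i
    rw [inputCode_edges]
    split_ifs with h
    · have hx0 : inputColour n x = 0 := congrArg Fin.val h
      rw [hnull] at hx0
      subst hx0
      exact Fin.ext hnil
    · exact inputColour_edge hK4 h0 h1 h2 h3 i x fun h' => h (Fin.ext h')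
  · intro x
    refine (Fin.ext_iff (b := (1 : Fin (n + 6 + 2)))).trans ((hroot x.1).trans ?_)
    exact (Subtype.ext_iff (a1 := x) (a2 := (runHeap L hK).root)).symm
  · intro x
    refine (Fin.ext_iff (b := (0 : Fin (n + 6 + 2)))).trans ((hnull x.1).trans ?_)
    exact (Subtype.ext_iff (a1 := x) (a2 := (runHeap L hK).null)).symm

/-! ### The reduction -/

theorem satisfies_congr {H G G' : Graph} (e : G.V ≃ G'.V) (hnull : e G.null = G'.null)
    (hroot : e G.root = G'.root) (he : ∀ i x y, G.s i x y ↔ G'.s i (e x) (e y)) :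
    Satisfies H G ↔ Satisfies H G' := by
  constructor
  · rintro ⟨φ, h1, h2, h3⟩
    refine ⟨e ∘ φ, fun i x y h => (he _ _ _).1 (h1 i x y h), fun x => ?_, fun x => ?_⟩
    · rw [← h2, ← hroot]; exact e.apply_eq_iff_eq
    · rw [← h3, ← hnull]; exact e.apply_eq_iff_eq
  · rintro ⟨φ, h1, h2, h3⟩
    refine ⟨e.symm ∘ φ, fun i x y h => (he _ _ _).2 ?_, fun x => ?_, fun x => ?_⟩
    · simpa using h1 i x y h
    · rw [← h2, ← hroot]; exact e.symm_apply_eq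
    · rw [← h3, ← hnull]; exact e.symm_apply_eq

/-- The initial state of the simulator, as an element of the finite set of its states. -/
def simStart (c : Turing.ToPartrec.Code) : simStates c :=
  ⟨(simInit c []).state, simInit_state_mem c []⟩

/-- The input graph fails to imply the error graph exactly if the program halts on its input. -/
theorem impliesOver_iff_not_dom (c : Turing.ToPartrec.Code) (n : ℕ) :
    ImpliesOver IsHeap (GraphCode.toGraph (inputCode n)) (errorGraph simulator (simStart c)) ↔
      ¬(c.eval [2 ^ n - 1]).Dom := by
  classical
  rw [← simulator_eval_dom, RotaryMachine.eval_dom_iff]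
  set d := simInit c [2 ^ n - 1]
  have hstart : d.state = simStart c := rfl
  have f0 : (simulator.run d 0).first = inputWord n := trList_two_pow_sub_one n
  have f1 : (simulator.run d 1).first = [] := rfl
  have f2 : (simulator.run d 2).first = [] := rfl
  have f3 : (simulator.run d 3).first = [] := rfl
  constructor
  · intro himp h
    have hmin := fun t ht => Nat.find_min h (m := t) ht
    exact not_satisfies_errorGraph_runHeap hstart (Nat.find_spec h) hmin
      (himp _ (isHeap_runHeap _) (satisfies_inputCode_runHeap _ (by omega) f0 f1 f2 f3))
  · intro h H hH hsat
    push Not at h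
    choose s hs using hH.1
    have hs' : ∀ i x y, H.s i x y ↔ s i x = y := fun i x y =>
      ⟨fun h => ((hs i x).2 y h).symm, by rintro rfl; exact (hs i x).1⟩
    obtain ⟨hroot, hroot₁, hroot₂, i0, i1, i2, i3⟩ := initial_of_satisfies_inputCode hs' hsat
    refine satisfies_errorGraph_of_not_halts hs' hroot hroot₁ hroot₂ (simStates_closed c) hstart
      (fun t => (s 0)^[t] (s 0 H.root)) rfl (fun t => Function.iterate_succ_apply' _ _ _) ?_ h
    intro t ht
    interval_cases t
    · rw [f0]; exact i0
    · rw [f1]; exact i1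
    · rw [f2]; exact i2
    · rw [f3]; exact i3

/-- A single program whose halting on the inputs `2 ^ n - 1` is undecidable. -/
theorem exists_code_not_computablePred :
    ∃ c : Turing.ToPartrec.Code, ¬ComputablePred fun n : ℕ => (c.eval [2 ^ n - 1]).Dom := by
  -- A primitive recursive left inverse of `fun n => 2 ^ n - 1`.
  let g : ℕ → ℕ := fun m => Nat.findGreatest (fun k => 2 ^ k = m + 1) m
  have hg : Primrec g := by
    refine Primrec.nat_findGreatest .id ?_
    exact Primrec.eq.comp
      ((Primrec₂.unpaired'.1 Nat.Primrec.pow).comp (.const 2) .snd) (Primrec.succ.comp .fst)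
  have hgn : ∀ n, g (2 ^ n - 1) = n := by
    intro n
    have hpos := Nat.one_le_two_pow (n := n)
    have hn : n ≤ 2 ^ n - 1 := by have := n.lt_two_pow_self; omega
    have h : 2 ^ g (2 ^ n - 1) = 2 ^ n - 1 + 1 :=
      Nat.findGreatest_spec (P := fun k => 2 ^ k = 2 ^ n - 1 + 1) hn (by omega)
    rw [Nat.sub_add_cancel hpos] at h
    exact Nat.pow_right_injective le_rfl h
  let f : ℕ →. ℕ := fun m => Nat.Partrec.Code.eval (Denumerable.ofNat Nat.Partrec.Code (g m)) 0
  have hf : Partrec f :=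
    Nat.Partrec.Code.eval_part.comp ((Computable.ofNat _).comp hg.to_comp) (Computable.const 0)
  obtain ⟨c, hc⟩ := Turing.ToPartrec.Code.exists_code (Nat.Partrec'.part_iff₁.2 hf)
  refine ⟨c, fun h => ComputablePred.halting_problem 0 ?_⟩
  refine ComputablePred.computable_of_manyOneReducible ⟨Encodable.encode, Computable.encode, ?_⟩ h
  intro a
  have e := hc ⟨[2 ^ Encodable.encode a - 1], rfl⟩
  change c.eval [2 ^ Encodable.encode a - 1] = pure <$> f (2 ^ Encodable.encode a - 1) at e
  rw [e]
  simp [f, hgn]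

end RegularGraph

theorem mainTheorem1 :
    ¬ ComputablePred (fun c : RegularGraph.GraphCode × RegularGraph.GraphCode =>
      RegularGraph.ImpliesOver RegularGraph.IsHeap
        (RegularGraph.GraphCode.toGraph c.1) (RegularGraph.GraphCode.toGraph c.2)) := by
  intro h
  obtain ⟨c, hc⟩ := RegularGraph.exists_code_not_computablePred
  obtain ⟨d, e, e1, e2, e3⟩ := RegularGraph.GraphCode.exists_iso
    (RegularGraph.errorGraph RegularGraph.simulator (RegularGraph.simStart c))
  refine hc ((ComputablePred.computable_of_manyOneReducible
    ⟨fun n => (RegularGraph.inputCode n, d), ?_, fun n => ?_⟩ h).not.of_eq fun n => not_not)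
  · exact RegularGraph.primrec_inputCode.to_comp.pair (Computable.const d)
  · rw [← RegularGraph.impliesOver_iff_not_dom]
    refine forall_congr' fun H => forall_congr' fun _ => forall_congr' fun _ => ?_
    exact RegularGraph.satisfies_congr e e1 e2 e3
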